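/- Regard $\mathbb{RP}^n$ as a subset of $\mathbb{CP}^n$ in the canonical way. A totally real (resp. complex) projective variety is the zero locus in $\mathbb{RP}^n$ (resp. $\mathbb{CP}^n$) of some set of real (resp. complex) homogeneous polynomials in $n+1$ variables. It is irreducible if it is nonempty and is not the union of two projective varieties both different from it. The cone of a subset of projective space consists of $0$ and all vectors representing its points. The dimension of a projective variety is the maximal length of a chain of prime ideals in the quotient of the polynomial ring by the ideal of the polynomials vanishing on its cone, minus $1$. For $X\subseteq\mathbb{RP}^n$, let $I^{\mathbb C}(X)\subseteq\mathbb C[z_0,\dots,z_n]$ be the ideal generated by the complex homogeneous polynomials that vanish on the real cone of $X$, and let $ZI(X)\subseteq\mathbb{CP}^n$ be the zero locus of $I^{\mathbb C}(X)$ (the complexification of $X$). Let $X\subseteq\mathbb{RP}^n$ be a totally real projective variety. (1) If $Y\subseteq X$ is a totally real projective variety, then $ZI(Y)\cap X=Y$. (2) If $Y\subseteq X$ is an irreducible totally real projective variety of dimension $p$, then $ZI(Y)$ is an irreducible complex projective variety of dimension $p$ contained in $ZI(X)$. (3) If $V\subseteq ZI(X)$ is an irreducible complex projective variety of dimension $p$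 and $\dim_{\mathbb R}(V\cap X)=p$, then $V\cap X$ is an irreducible totally real projective variety and $ZI(V\cap X)=V$. (4) Consequently, for every $p\ge 0$, the map $\sum_i n_iY_i\mapsto\sum_i n_i\,ZI(Y_i)$ sends the totally real $p$-cycles on $X$ (formal integral combinations of irreducible $p$-dimensional totally real projective varieties contained in $X$) injectively to $p$-cycles on $ZI(X)$ (formal integral combinations of irreducible $p$-dimensional complex projective varieties contained in $ZI(X)$), and it sends effective cycles (no negative coefficient) to effective cycles. -/

import Mathlib

open scoped LinearAlgebra.Projectivization

noncomputable section

namespace TotallyReal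

/-- Projective `n`-space over the field `k`, as the set of lines in `k ^ (n + 1)`. -/
abbrev PSpace (k : Type*) [Field k] (n : ℕ) : Type _ := ℙ k (Fin (n + 1) → k)

section Field

variable {k : Type*} [Field k] {n : ℕ}

/-- The common zeros in projective space of a set `S` of polynomials: the points all of whose
homogeneous coordinate vectors are zeros of every member of `S`. It is used only for sets of
homogeneous polynomials and for homogeneous ideals. -/
def projZeroLocus (S : Set (MvPolynomial (Fin (n + 1)) k)) : Set (PSpace k n) :=
  {x | ∀ f ∈ S, ∀ (v : Fin (n + 1) → k) (hv : v ≠ 0),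
    Projectivization.mk k v hv = x → MvPolynomial.eval v f = 0}

/-- A projective variety: the zero locus of some homogeneous polynomials. It may be reducible
or empty. For `k = ℝ` these are the totally real projective varieties. -/
def IsProjVariety (X : Set (PSpace k n)) : Prop :=
  ∃ S : Set (MvPolynomial (Fin (n + 1)) k),
    (∀ f ∈ S, ∃ d : ℕ, f.IsHomogeneous d) ∧ X = projZeroLocus S

/-- An irreducible projective variety: nonempty, and not the union of two projective varieties
that are both different from it. -/
def IsIrredProjVariety (X : Set (PSpace k n)) : Prop :=
  IsProjVariety X ∧ X.Nonempty ∧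
    ∀ A B : Set (PSpace k n), IsProjVariety A → IsProjVariety B → X = A ∪ B → X = A ∨ X = B

/-- The cone over a subset of projective space: all the vectors on its lines, and `0`. -/
def cone (X : Set (PSpace k n)) : Set (Fin (n + 1) → k) :=
  {v | ∃ hv : v ≠ 0, Projectivization.mk k v hv ∈ X} ∪ {0}

/-- The dimension of a subset of affine space: the maximal length of a chain of prime ideals in
the ring of polynomials modulo those that vanish on the set. -/
def affineDim {m : ℕ} (V : Set (Fin m → k)) : WithBot ℕ∞ :=
  ringKrullDim (MvPolynomial (Fin m) k ⧸ MvPolynomial.vanishingIdeal k V)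

/-- `X` has projective dimension `p`: the dimension of its cone minus `1` is `p`. -/
def HasProjDim (X : Set (PSpace k n)) (p : ℕ) : Prop :=
  affineDim (cone X) = (p : WithBot ℕ∞) + 1

/-- The ideal generated by the homogeneous polynomials that vanish on a set of vectors. -/
def homogIdeal (C : Set (Fin (n + 1) → k)) : Ideal (MvPolynomial (Fin (n + 1)) k) :=
  Ideal.span {f | (∃ d : ℕ, f.IsHomogeneous d) ∧ ∀ v ∈ C, MvPolynomial.eval v f = 0}

/-- The irreducible `p`-dimensional projective subvarieties of `X`. -/
def irredSubvarieties (X : Set (PSpace k n)) (p : ℕ) : Set (Set (PSpace k n)) :=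
  {Y | Y ⊆ X ∧ IsIrredProjVariety Y ∧ HasProjDim Y p}

/-- The `p`-cycles on `X`: the formal integral combinations of irreducible `p`-dimensional
projective subvarieties of `X`. -/
def cycles (X : Set (PSpace k n)) (p : ℕ) : Submodule ℤ (Set (PSpace k n) →₀ ℤ) :=
  Finsupp.supported ℤ ℤ (irredSubvarieties X p)

end Field

section Complexification

variable {n : ℕ}

/-- The canonical inclusion of `ℝ ^ (n + 1)` in `ℂ ^ (n + 1)`. -/
def ofRealVec (n : ℕ) : (Fin (n + 1) → ℝ) →ₛₗ[Complex.ofRealHom] (Fin (n + 1) → ℂ) where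
  toFun v := fun i => (v i : ℂ)
  map_add' v w := by ext i; simp
  map_smul' a v := by ext i; simp

theorem ofRealVec_injective (n : ℕ) : Function.Injective (ofRealVec n) := by
  intro v w h
  ext i
  exact Complex.ofReal_injective (congrFun h i)

/-- The canonical embedding of real projective space in complex projective space. -/
def realPoints (n : ℕ) : PSpace ℝ n → PSpace ℂ n :=
  Projectivization.map (ofRealVec n) (ofRealVec_injective n)

/-- The ideal generated by the complex homogeneous polynomials that vanish on the real cone of
`X`, regarded as a subset of `ℂ ^ (n + 1)`. -/
def complexIdeal (X : Set (PSpace ℝ n)) : Ideal (MvPolynomial (Fin (n + 1)) ℂ) :=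
  homogIdeal (ofRealVec n '' cone X)

/-- The complexification `ZI(X)`: the complex projective variety defined by `complexIdeal X`. -/
def ZI (X : Set (PSpace ℝ n)) : Set (PSpace ℂ n) :=
  projZeroLocus (complexIdeal X : Set (MvPolynomial (Fin (n + 1)) ℂ))

/-- The complexification of cycles, `∑ nᵢ Yᵢ ↦ ∑ nᵢ ZI(Yᵢ)`. -/
def complexifyCycle (n : ℕ) : (Set (PSpace ℝ n) →₀ ℤ) →ₗ[ℤ] (Set (PSpace ℂ n) →₀ ℤ) :=
  Finsupp.lmapDomain ℤ ℤ (ZI (n := n))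

end Complexification

end TotallyReal

end

/-!
`ZI` is the Zariski closure of real points: on cones, `ZI X` is the closure in `ℂ ^ (n + 1)` of the
real cone of `X`. Conversely the real points of a complex variety form a totally real variety,
because a polynomial with complex coefficients vanishes at a real vector if and only if all the real
polynomials obtained by applying an `ℝ`-linear form `ℂ → ℝ` to its coefficients do. Hence
`ZI X ⊆ V ↔ X ⊆ V(ℝ)` for every complex variety `V`, and `(ZI Y)(ℝ) = Y` for every totally real
variety `Y`. Irreducibility passes between `Y` and `ZI Y` by these two facts alone.

The dimension is preserved because the coordinate ring of the cone of `ZI X` is integral over that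
of the cone of `X`. Part (3) follows: `ZI (V ∩ X)` is a subvariety of the irreducible variety `V`
of the same dimension, so it is all of `V`.
-/

namespace TotallyReal

open MvPolynomial

section KrullDim

theorem ringKrullDim_eq_of_isIntegral (R S : Type*) [CommRing R] [CommRing S] [Algebra R S]
    [Algebra.IsIntegral R S] [FaithfulSMul R S] : ringKrullDim S = ringKrullDim R := by
  refine le_antisymm (Order.krullDim_le_of_strictMono (PrimeSpectrum.comap (algebraMap R S))
    fun P Q h => Ideal.IsIntegral.comap_lt_comap (R := R) (I := P.asIdeal) (J := Q.asIdeal) h) ?_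
  refine iSup_le fun l => ?_
  obtain ⟨P, _, _⟩ := Ideal.nonempty_primesOver (S := S) (RelSeries.head l).asIdeal
  obtain ⟨L, hL, -⟩ := Ideal.exists_ltSeries_of_hasGoingUp l P
  rw [← hL]
  exact le_iSup (fun L : LTSeries (PrimeSpectrum S) => (L.length : WithBot ℕ∞)) L

theorem eq_of_le_of_ringKrullDim_quotient_eq {R : Type*} [CommRing R] {P J : Ideal R}
    [P.IsPrime] (hPJ : P ≤ J) {d : ℕ} (hP : ringKrullDim (R ⧸ P) = d)
    (hJ : ringKrullDim (R ⧸ J) = d) : P = J := by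
  refine le_antisymm hPJ fun f hf => ?_
  by_contra hfP
  have hdim := ringKrullDim_succ_le_of_surjective (Ideal.Quotient.factor hPJ)
    (Ideal.Quotient.factor_surjective hPJ) (r := Ideal.Quotient.mk P f)
    (mem_nonZeroDivisors_of_ne_zero (by rwa [Ne, Ideal.Quotient.eq_zero_iff_mem]))
    (by rwa [Ideal.Quotient.factor_mk, Ideal.Quotient.eq_zero_iff_mem])
  rw [hP, hJ] at hdim
  have : d + 1 ≤ d := by exact_mod_cast hdim
  omega

end KrullDim

section ZariskiClosure

variable {σ k : Type*} [Field k]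

theorem mem_vanishingIdeal_iff_eval {C : Set (σ → k)} {f : MvPolynomial σ k} :
    f ∈ vanishingIdeal k C ↔ ∀ v ∈ C, eval v f = 0 := by
  simp only [mem_vanishingIdeal_iff, aeval_eq_eval]

/-- The Zariski closure of a set of points of affine space: the common zeros of the polynomials
that vanish on it. -/
def zariskiClosure (C : Set (σ → k)) : Set (σ → k) :=
  zeroLocus k (vanishingIdeal k C)

theorem mem_zariskiClosure_iff {C : Set (σ → k)} {v : σ → k} :
    v ∈ zariskiClosure C ↔ ∀ f ∈ vanishingIdeal k C, eval v f = 0 := by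
  simp only [zariskiClosure, mem_zeroLocus_iff, aeval_eq_eval]

theorem subset_zariskiClosure (C : Set (σ → k)) : C ⊆ zariskiClosure C :=
  zeroLocus_vanishingIdeal_le C

theorem zariskiClosure_mono {C D : Set (σ → k)} (h : C ⊆ D) :
    zariskiClosure C ⊆ zariskiClosure D :=
  zeroLocus_anti_mono (vanishingIdeal_anti_mono h)

theorem zariskiClosure_subset_iff {C D : Set (σ → k)} (hD : zariskiClosure D = D) :
    zariskiClosure C ⊆ D ↔ C ⊆ D :=
  ⟨(subset_zariskiClosure C).trans, fun h => (zariskiClosure_mono h).trans hD.subset⟩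

theorem vanishingIdeal_zariskiClosure (C : Set (σ → k)) :
    vanishingIdeal k (zariskiClosure C) = vanishingIdeal k C :=
  zeroLocus_vanishingIdeal_galoisConnection.u_l_u_eq_u (OrderDual.toDual C)

end ZariskiClosure

section ExtensionOfScalars

variable {σ k K : Type*} [Field k] [Field K] [Algebra k K]

theorem map_mem_vanishingIdeal_image_iff {C : Set (σ → k)} {f : MvPolynomial σ k} :
    map (algebraMap k K) f ∈ vanishingIdeal K ((algebraMap k K ∘ ·) '' C) ↔
      f ∈ vanishingIdeal k C := by
  simp only [mem_vanishingIdeal_iff_eval, Set.forall_mem_image]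
  refine forall₂_congr fun v _ => ?_
  rw [← map_eq_zero (algebraMap k K), map_eval]

theorem exists_eval_eq_dual_eval (φ : Module.Dual k K) (f : MvPolynomial σ K) :
    ∃ g : MvPolynomial σ k, ∀ v : σ → k, eval v g = φ (eval (algebraMap k K ∘ v) f) := by
  refine ⟨∑ m ∈ f.support, monomial m (φ (coeff m f)), fun v => ?_⟩
  rw [eval_eq (algebraMap k K ∘ v) f, map_sum, map_sum]
  refine Finset.sum_congr rfl fun m _ => ?_
  simp only [eval_monomial, Finsupp.prod, Function.comp_apply, ← map_pow, ← map_prod]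
  rw [mul_comm (coeff m f), ← Algebra.smul_def, map_smul, smul_eq_mul, mul_comm]

theorem preimage_zariskiClosure_image (C : Set (σ → k)) :
    (algebraMap k K ∘ ·) ⁻¹' zariskiClosure ((algebraMap k K ∘ ·) '' C) = zariskiClosure C := by
  ext v
  simp only [Set.mem_preimage, mem_zariskiClosure_iff]
  refine ⟨fun h f hf => ?_, fun h f hf => (Module.forall_dual_apply_eq_zero_iff k _).1 fun φ => ?_⟩
  · have := h _ (map_mem_vanishingIdeal_image_iff.2 hf)
    rwa [← map_eval, map_eq_zero] at this
  · obtain ⟨g, hg⟩ := exists_eval_eq_dual_eval φ f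
    rw [← hg]
    refine h g (mem_vanishingIdeal_iff_eval.2 fun w hw => ?_)
    rw [hg, mem_vanishingIdeal_iff_eval.1 hf _ ⟨w, hw, rfl⟩, map_zero]

attribute [local instance] algebraMvPolynomial

theorem ringKrullDim_quotient_vanishingIdeal_image [Algebra.IsIntegral k K] (C : Set (σ → k)) :
    ringKrullDim (MvPolynomial σ K ⧸ vanishingIdeal K ((algebraMap k K ∘ ·) '' C)) =
      ringKrullDim (MvPolynomial σ k ⧸ vanishingIdeal k C) := by
  have : Algebra.IsIntegral (MvPolynomial σ k) (MvPolynomial σ K) :=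
    ⟨fun f => isIntegral_iff_isIntegral_coeff.2 fun m => Algebra.IsIntegral.isIntegral _⟩
  have : (vanishingIdeal K ((algebraMap k K ∘ ·) '' C)).LiesOver (vanishingIdeal k C) :=
    ⟨by ext f; exact map_mem_vanishingIdeal_image_iff.symm⟩
  exact ringKrullDim_eq_of_isIntegral _ _

end ExtensionOfScalars

section Homogeneous

theorem eval_smul_of_isHomogeneous {σ R : Type*} [CommSemiring R] {f : MvPolynomial σ R} {d : ℕ}
    (hf : f.IsHomogeneous d) (t : R) (v : σ → R) : eval (t • v) f = t ^ d * eval v f := by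
  rw [eval_eq, eval_eq, Finset.mul_sum]
  refine Finset.sum_congr rfl fun m hm => ?_
  have hd : ∑ i ∈ m.support, m i = d := by
    simpa only [Finsupp.weight_apply, Finsupp.sum, Pi.one_apply, smul_eq_mul, mul_one] using
      hf (mem_support_iff.1 hm)
  simp only [Pi.smul_apply, smul_eq_mul, mul_pow, Finset.prod_mul_distrib,
    Finset.prod_pow_eq_pow_sum, hd]
  ring

variable {σ k : Type*} [Field k] {n : ℕ}

theorem homogeneousComponent_mem_vanishingIdeal {C : Set (σ → k)} {T : Set k} (hT : T.Infinite)
    (hC : ∀ t ∈ T, ∀ v ∈ C, t • v ∈ C) {f : MvPolynomial σ k} (hf : f ∈ vanishingIdeal k C)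
    (d : ℕ) : homogeneousComponent d f ∈ vanishingIdeal k C := by
  rw [mem_vanishingIdeal_iff_eval] at hf ⊢
  intro v hv
  -- The polynomial `t ↦ f (t v)`, whose coefficients are the values at `v` of the components.
  let q : Polynomial k := ∑ i ∈ Finset.range (f.totalDegree + 1),
    Polynomial.monomial i (eval v (homogeneousComponent i f))
  have hq : q = 0 := by
    refine Polynomial.eq_zero_of_infinite_isRoot q (hT.mono fun t ht => ?_)
    have h := hf _ (hC t ht v hv)
    rw [← sum_homogeneousComponent f, map_sum] at h
    simp only [eval_smul_of_isHomogeneous (homogeneousComponent_isHomogeneous _ f)] at h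
    simpa [q, Polynomial.eval_finsetSum, mul_comm] using h
  by_cases hd : d < f.totalDegree + 1
  · simpa [q, Polynomial.finsetSum_coeff, Polynomial.coeff_monomial, hd] using
      congrArg (Polynomial.coeff · d) hq
  · rw [homogeneousComponent_eq_zero _ _ (by omega), map_zero]

theorem homogIdeal_eq_vanishingIdeal {C : Set (Fin (n + 1) → k)} {T : Set k} (hT : T.Infinite)
    (hC : ∀ t ∈ T, ∀ v ∈ C, t • v ∈ C) : homogIdeal C = vanishingIdeal k C := by
  refine le_antisymm (Ideal.span_le.2 fun f hf => mem_vanishingIdeal_iff_eval.2 hf.2)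
    fun f hf => ?_
  rw [← sum_homogeneousComponent f]
  exact Ideal.sum_mem _ fun i _ => Ideal.subset_span
    ⟨⟨i, homogeneousComponent_isHomogeneous i f⟩, mem_vanishingIdeal_iff_eval.1
      (homogeneousComponent_mem_vanishingIdeal hT hC hf i)⟩

end Homogeneous

section Cone

variable {k : Type*} [Field k] {n : ℕ} {X Y : Set (PSpace k n)}

theorem zero_mem_cone (X : Set (PSpace k n)) : 0 ∈ cone X := Or.inr rfl

theorem mem_cone_iff {v : Fin (n + 1) → k} (hv : v ≠ 0) :
    v ∈ cone X ↔ Projectivization.mk k v hv ∈ X := by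
  simp [cone, hv]

theorem smul_mem_cone (t : k) {v : Fin (n + 1) → k} (hv : v ∈ cone X) : t • v ∈ cone X := by
  by_cases h : t • v = 0
  · exact h ▸ zero_mem_cone X
  · have hv0 : v ≠ 0 := fun h0 => h (by rw [h0, smul_zero])
    rw [mem_cone_iff h]
    rw [mem_cone_iff hv0] at hv
    rwa [(Projectivization.mk_eq_mk_iff' k (t • v) v h hv0).2 ⟨t, rfl⟩]

theorem cone_subset_cone_iff : cone X ⊆ cone Y ↔ X ⊆ Y := by
  refine ⟨fun h x hx => ?_, fun h => Set.union_subset_union_left _ fun v hv =>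
    ⟨hv.1, h hv.2⟩⟩
  induction x using Projectivization.ind with
  | h v hv => exact (mem_cone_iff hv).1 (h ((mem_cone_iff hv).2 hx))

theorem cone_injective : Function.Injective (cone : Set (PSpace k n) → _) := fun _ _ h =>
  (cone_subset_cone_iff.1 h.subset).antisymm (cone_subset_cone_iff.1 h.superset)

theorem homogIdeal_cone [Infinite k] (X : Set (PSpace k n)) :
    homogIdeal (cone X) = vanishingIdeal k (cone X) :=
  homogIdeal_eq_vanishingIdeal Set.infinite_univ fun t _ _ => smul_mem_cone t

theorem vanishingIdeal_cone_ne_top (X : Set (PSpace k n)) : vanishingIdeal k (cone X) ≠ ⊤ := by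
  rw [Ideal.ne_top_iff_one, mem_vanishingIdeal_iff_eval]
  exact fun h => one_ne_zero ((map_one _).symm.trans (h 0 (zero_mem_cone X)))

end Cone

section ProjVariety

variable {k : Type*} [Field k] {n : ℕ} {X Y : Set (PSpace k n)}

theorem mk_mem_projZeroLocus_iff {S : Set (MvPolynomial (Fin (n + 1)) k)}
    (hS : ∀ f ∈ S, ∃ d : ℕ, f.IsHomogeneous d) {v : Fin (n + 1) → k} (hv : v ≠ 0) :
    Projectivization.mk k v hv ∈ projZeroLocus S ↔ ∀ f ∈ S, eval v f = 0 := by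
  refine ⟨fun h f hf => h f hf v hv rfl, fun h f hf w hw hwv => ?_⟩
  obtain ⟨t, rfl⟩ := (Projectivization.mk_eq_mk_iff' k w v hw hv).1 hwv
  obtain ⟨d, hd⟩ := hS f hf
  rw [eval_smul_of_isHomogeneous hd, h f hf, mul_zero]

theorem projZeroLocus_span (S : Set (MvPolynomial (Fin (n + 1)) k)) :
    projZeroLocus (Ideal.span S : Set (MvPolynomial (Fin (n + 1)) k)) = projZeroLocus S := by
  refine Set.Subset.antisymm (fun x hx f hf => hx f (Ideal.subset_span hf))
    fun x hx f hf v hv hvx => ?_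
  have : Ideal.span S ≤ RingHom.ker (eval v) := Ideal.span_le.2 fun g hg => hx g hg v hv hvx
  exact this hf

theorem projZeroLocus_union (S T : Set (MvPolynomial (Fin (n + 1)) k)) :
    projZeroLocus (S ∪ T) = projZeroLocus S ∩ projZeroLocus T :=
  Set.ext fun _ => by
    simp only [projZeroLocus, Set.mem_union, or_imp, forall_and, Set.mem_ofPred_eq,
      Set.mem_inter_iff]

theorem IsProjVariety.inter (hX : IsProjVariety X) (hY : IsProjVariety Y) :
    IsProjVariety (X ∩ Y) := by
  obtain ⟨S, hS, rfl⟩ := hX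
  obtain ⟨T, hT, rfl⟩ := hY
  exact ⟨S ∪ T, fun f hf => hf.elim (hS f) (hT f), (projZeroLocus_union S T).symm⟩

section Pointwise

open scoped Pointwise

theorem exists_isHomogeneous_of_mem_mul {S T : Set (MvPolynomial (Fin (n + 1)) k)}
    (hS : ∀ f ∈ S, ∃ d : ℕ, f.IsHomogeneous d) (hT : ∀ f ∈ T, ∃ d : ℕ, f.IsHomogeneous d) :
    ∀ f ∈ S * T, ∃ d : ℕ, f.IsHomogeneous d := by
  rintro _ ⟨f, hf, g, hg, rfl⟩
  obtain ⟨d, hd⟩ := hS f hf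
  obtain ⟨e, he⟩ := hT g hg
  exact ⟨d + e, hd.mul he⟩

theorem projZeroLocus_mul {S T : Set (MvPolynomial (Fin (n + 1)) k)}
    (hS : ∀ f ∈ S, ∃ d : ℕ, f.IsHomogeneous d) (hT : ∀ f ∈ T, ∃ d : ℕ, f.IsHomogeneous d) :
    projZeroLocus (S * T) = projZeroLocus S ∪ projZeroLocus T := by
  ext x
  induction x using Projectivization.ind with
  | h v hv =>
    rw [Set.mem_union, mk_mem_projZeroLocus_iff (exists_isHomogeneous_of_mem_mul hS hT),
      mk_mem_projZeroLocus_iff hS, mk_mem_projZeroLocus_iff hT, ← Set.image2_mul]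
    simp only [Set.forall_mem_image2, map_mul, mul_eq_zero]
    grind

theorem IsProjVariety.union (hX : IsProjVariety X) (hY : IsProjVariety Y) :
    IsProjVariety (X ∪ Y) := by
  obtain ⟨S, hS, rfl⟩ := hX
  obtain ⟨T, hT, rfl⟩ := hY
  exact ⟨S * T, exists_isHomogeneous_of_mem_mul hS hT, (projZeroLocus_mul hS hT).symm⟩

end Pointwise

theorem isProjVariety_empty : IsProjVariety (∅ : Set (PSpace k n)) := by
  refine ⟨{1}, by rintro _ rfl; exact ⟨0, isHomogeneous_one _ _⟩, Set.ext fun x => ?_⟩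
  refine iff_of_false (Set.notMem_empty x) fun hx => one_ne_zero (α := k) ?_
  simpa using hx 1 rfl x.rep x.rep_nonzero x.mk_rep

theorem cone_projZeroLocus_homogIdeal {C : Set (Fin (n + 1) → k)} (hC : 0 ∈ C) :
    cone (projZeroLocus (homogIdeal C : Set (MvPolynomial (Fin (n + 1)) k))) =
      zeroLocus k (homogIdeal C) := by
  rw [homogIdeal, projZeroLocus_span, zeroLocus_span]
  ext v
  rw [Set.mem_ofPred_eq]
  by_cases hv : v = 0
  · subst hv
    exact iff_of_true (zero_mem_cone _) fun f hf => hf.2 0 hC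
  · exact (mem_cone_iff hv).trans (mk_mem_projZeroLocus_iff (fun f hf => hf.1) hv)

theorem IsProjVariety.zariskiClosure_cone (hX : IsProjVariety X) :
    zariskiClosure (cone X) = cone X := by
  refine Set.Subset.antisymm (fun v hv => ?_) (subset_zariskiClosure _)
  rw [mem_zariskiClosure_iff] at hv
  by_cases hv0 : v = 0
  · exact hv0 ▸ zero_mem_cone X
  obtain ⟨S, hS, rfl⟩ := hX
  refine (mem_cone_iff hv0).2 ((mk_mem_projZeroLocus_iff hS hv0).2 fun f hf => ?_)
  obtain ⟨i, hi⟩ := Function.ne_iff.1 hv0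
  -- A nonzero constant `f` does not vanish at the vertex of the cone, but `X i * f` always does.
  have hXf : MvPolynomial.X i * f ∈ vanishingIdeal k (cone (projZeroLocus S)) := by
    refine mem_vanishingIdeal_iff_eval.2 fun w hw => ?_
    rcases hw with ⟨hw, hwS⟩ | rfl
    · rw [map_mul, hwS f hf w hw rfl, mul_zero]
    · rw [map_mul, eval_X, Pi.zero_apply, zero_mul]
  have hvf := hv _ hXf
  rw [map_mul, eval_X] at hvf
  exact (mul_eq_zero.1 hvf).resolve_left hi

theorem isProjVariety_iff_zariskiClosure_cone [Infinite k] :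
    IsProjVariety X ↔ zariskiClosure (cone X) = cone X := by
  refine ⟨IsProjVariety.zariskiClosure_cone, fun h => ?_⟩
  have hX : X = projZeroLocus (homogIdeal (cone X) : Set (MvPolynomial (Fin (n + 1)) k)) := by
    apply cone_injective
    rw [cone_projZeroLocus_homogIdeal (zero_mem_cone X), homogIdeal_cone]
    exact h.symm
  exact ⟨_, fun f hf => hf.1, hX.trans (projZeroLocus_span _)⟩

theorem IsProjVariety.eq_of_vanishingIdeal_eq (hX : IsProjVariety X) (hY : IsProjVariety Y)
    (h : vanishingIdeal k (cone X) = vanishingIdeal k (cone Y)) : X = Y := by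
  apply cone_injective
  rw [← hX.zariskiClosure_cone, ← hY.zariskiClosure_cone, zariskiClosure, zariskiClosure, h]

end ProjVariety

section Irreducible

variable {k : Type*} [Field k] {n : ℕ} {X Y : Set (PSpace k n)}

theorem isIrredProjVariety_iff_subset_or_subset :
    IsIrredProjVariety X ↔ IsProjVariety X ∧ X.Nonempty ∧
      ∀ A B : Set (PSpace k n), IsProjVariety A → IsProjVariety B → X ⊆ A ∪ B →
        X ⊆ A ∨ X ⊆ B := by
  refine and_congr_right fun hX => and_congr_right fun _ =>
    ⟨fun h A B hA hB hAB => ?_, fun h A B hA hB hAB => ?_⟩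
  · refine (h _ _ (hX.inter hA) (hX.inter hB) ?_).imp Set.left_eq_inter.1 Set.left_eq_inter.1
    rwa [← Set.inter_union_distrib_left, Set.left_eq_inter]
  · exact (h A B hA hB hAB.subset).imp (fun hXA => hXA.antisymm (hAB ▸ Set.subset_union_left))
      fun hXB => hXB.antisymm (hAB ▸ Set.subset_union_right)

theorem subset_projZeroLocus_singleton_iff (hX : X.Nonempty) {f : MvPolynomial (Fin (n + 1)) k}
    {d : ℕ} (hf : f.IsHomogeneous d) :
    X ⊆ projZeroLocus {f} ↔ f ∈ vanishingIdeal k (cone X) := by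
  refine ⟨fun h => mem_vanishingIdeal_iff_eval.2 fun v hv => ?_, fun h x hx g hg v hv hvx => ?_⟩
  · rcases hv with ⟨hv, hvX⟩ | rfl
    · exact h hvX f rfl v hv rfl
    · obtain ⟨x, hx⟩ := hX
      have h0 := eval_smul_of_isHomogeneous hf 0 x.rep
      rwa [zero_smul, h hx f rfl x.rep x.rep_nonzero x.mk_rep, mul_zero] at h0
  · subst hg hvx
    exact mem_vanishingIdeal_iff_eval.1 h v ((mem_cone_iff hv).2 hx)

section GradedRing

attribute [local instance] MvPolynomial.gradedAlgebra

theorem isHomogeneous_vanishingIdeal_cone [Infinite k] (X : Set (PSpace k n)) :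
    (vanishingIdeal k (cone X)).IsHomogeneous (homogeneousSubmodule (Fin (n + 1)) k) := by
  intro d f hf
  have h := homogeneousComponent_mem_vanishingIdeal Set.infinite_univ
    (fun (t : k) _ _ hv => smul_mem_cone t hv) hf d
  rwa [← decomposition.decompose'_apply] at h

theorem IsIrredProjVariety.isPrime_vanishingIdeal_cone [Infinite k] (hX : IsIrredProjVariety X) :
    (vanishingIdeal k (cone X)).IsPrime := by
  obtain ⟨-, hne, hirr⟩ := isIrredProjVariety_iff_subset_or_subset.1 hX
  refine (isHomogeneous_vanishingIdeal_cone X).isPrime_of_homogeneous_mem_or_mem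
    (vanishingIdeal_cone_ne_top X) ?_
  rintro f g ⟨d, hf⟩ ⟨e, hg⟩ hfg
  have hf' : ∀ a ∈ ({f} : Set _), ∃ d : ℕ, a.IsHomogeneous d := by rintro _ rfl; exact ⟨d, hf⟩
  have hg' : ∀ a ∈ ({g} : Set _), ∃ d : ℕ, a.IsHomogeneous d := by rintro _ rfl; exact ⟨e, hg⟩
  rw [← subset_projZeroLocus_singleton_iff hne (hf.mul hg), ← Set.singleton_mul_singleton,
    projZeroLocus_mul hf' hg'] at hfg
  rw [← subset_projZeroLocus_singleton_iff hne hf, ← subset_projZeroLocus_singleton_iff hne hg]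
  exact hirr _ _ ⟨_, hf', rfl⟩ ⟨_, hg', rfl⟩ hfg

end GradedRing

theorem IsIrredProjVariety.eq_of_subset_of_hasProjDim [Infinite k] (hX : IsIrredProjVariety X)
    (hY : IsProjVariety Y) (hYX : Y ⊆ X) {p : ℕ} (hXp : HasProjDim X p) (hYp : HasProjDim Y p) :
    Y = X := by
  have := hX.isPrime_vanishingIdeal_cone
  refine hY.eq_of_vanishingIdeal_eq hX.1 (eq_of_le_of_ringKrullDim_quotient_eq (d := p + 1)
    (vanishingIdeal_anti_mono (cone_subset_cone_iff.2 hYX)) ?_ ?_).symm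
  · exact_mod_cast hXp
  · exact_mod_cast hYp

end Irreducible

section Complexification

variable {n : ℕ} {X Y : Set (PSpace ℝ n)} {V : Set (PSpace ℂ n)}

theorem complexIdeal_eq_vanishingIdeal (X : Set (PSpace ℝ n)) :
    complexIdeal X = vanishingIdeal ℂ (ofRealVec n '' cone X) := by
  refine homogIdeal_eq_vanishingIdeal
    (Set.infinite_range_of_injective Complex.ofReal_injective) ?_
  rintro _ ⟨t, rfl⟩ _ ⟨v, hv, rfl⟩
  exact ⟨t • v, smul_mem_cone t hv, (ofRealVec n).map_smulₛₗ t v⟩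

theorem isProjVariety_ZI (X : Set (PSpace ℝ n)) : IsProjVariety (ZI X) :=
  ⟨_, fun _ hf => hf.1, projZeroLocus_span _⟩

theorem cone_ZI (X : Set (PSpace ℝ n)) :
    cone (ZI X) = zariskiClosure (ofRealVec n '' cone X) := by
  rw [zariskiClosure, ← complexIdeal_eq_vanishingIdeal]
  exact cone_projZeroLocus_homogIdeal ⟨0, zero_mem_cone X, map_zero _⟩

theorem cone_preimage_realPoints (V : Set (PSpace ℂ n)) :
    cone (realPoints n ⁻¹' V) = ofRealVec n ⁻¹' cone V := by
  ext v
  by_cases hv : v = 0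
  · subst hv
    exact iff_of_true (zero_mem_cone _) (Or.inr (map_zero (ofRealVec n)))
  · have hv' : ofRealVec n v ≠ 0 := fun h =>
      hv (ofRealVec_injective n (h.trans (map_zero _).symm))
    rw [mem_cone_iff hv, Set.mem_preimage, Set.mem_preimage, mem_cone_iff hv', realPoints,
      Projectivization.map_mk]

theorem preimage_zariskiClosure_image_ofRealVec (C : Set (Fin (n + 1) → ℝ)) :
    ofRealVec n ⁻¹' zariskiClosure (ofRealVec n '' C) = zariskiClosure C :=
  preimage_zariskiClosure_image (K := ℂ) C

theorem IsProjVariety.preimage_realPoints (hV : IsProjVariety V) :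
    IsProjVariety (realPoints n ⁻¹' V) := by
  rw [isProjVariety_iff_zariskiClosure_cone, cone_preimage_realPoints]
  refine Set.Subset.antisymm ?_ (subset_zariskiClosure _)
  rw [← preimage_zariskiClosure_image_ofRealVec]
  exact Set.preimage_mono <|
    (zariskiClosure_subset_iff hV.zariskiClosure_cone).2 (Set.image_preimage_subset _ _)

theorem preimage_realPoints_ZI (hY : IsProjVariety Y) : realPoints n ⁻¹' ZI Y = Y := by
  apply cone_injective
  rw [cone_preimage_realPoints, cone_ZI, preimage_zariskiClosure_image_ofRealVec,
    hY.zariskiClosure_cone]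

theorem ZI_subset_iff (hV : IsProjVariety V) : ZI X ⊆ V ↔ X ⊆ realPoints n ⁻¹' V := by
  rw [← cone_subset_cone_iff, cone_ZI, zariskiClosure_subset_iff hV.zariskiClosure_cone,
    Set.image_subset_iff, ← cone_preimage_realPoints, cone_subset_cone_iff]

theorem subset_preimage_realPoints_ZI (X : Set (PSpace ℝ n)) : X ⊆ realPoints n ⁻¹' ZI X :=
  (ZI_subset_iff (isProjVariety_ZI X)).1 subset_rfl

theorem ZI_mono (h : X ⊆ Y) : ZI X ⊆ ZI Y :=
  (ZI_subset_iff (isProjVariety_ZI Y)).2 (h.trans (subset_preimage_realPoints_ZI Y))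

theorem ZI_nonempty_iff : (ZI X).Nonempty ↔ X.Nonempty := by
  rw [← not_iff_not, Set.not_nonempty_iff_eq_empty, Set.not_nonempty_iff_eq_empty,
    ← Set.subset_empty_iff, ZI_subset_iff isProjVariety_empty, Set.preimage_empty,
    Set.subset_empty_iff]

theorem isIrredProjVariety_ZI_iff (hY : IsProjVariety Y) :
    IsIrredProjVariety (ZI Y) ↔ IsIrredProjVariety Y := by
  simp only [isIrredProjVariety_iff_subset_or_subset, isProjVariety_ZI, hY, true_and,
    ZI_nonempty_iff]
  refine and_congr_right fun _ => ⟨fun h A B hA hB hAB => ?_, fun h V W hV hW hVW => ?_⟩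
  · have hZI := h (ZI A) (ZI B) (isProjVariety_ZI A) (isProjVariety_ZI B)
    simpa only [ZI_subset_iff ((isProjVariety_ZI A).union (isProjVariety_ZI B)),
      ZI_subset_iff (isProjVariety_ZI _), Set.preimage_union, preimage_realPoints_ZI hA,
      preimage_realPoints_ZI hB, hAB, true_imp_iff] using hZI
  · rw [ZI_subset_iff (hV.union hW), Set.preimage_union] at hVW
    rw [ZI_subset_iff hV, ZI_subset_iff hW]
    exact h _ _ hV.preimage_realPoints hW.preimage_realPoints hVW

theorem affineDim_cone_ZI (X : Set (PSpace ℝ n)) :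
    affineDim (cone (ZI X)) = affineDim (cone X) := by
  rw [affineDim, cone_ZI, vanishingIdeal_zariskiClosure]
  exact ringKrullDim_quotient_vanishingIdeal_image (K := ℂ) (cone X)

theorem hasProjDim_ZI_iff {p : ℕ} : HasProjDim (ZI X) p ↔ HasProjDim X p := by
  rw [HasProjDim, HasProjDim, affineDim_cone_ZI]

theorem ZI_eq_of_subset_of_hasProjDim (hV : IsIrredProjVariety V) {p : ℕ} (hVp : HasProjDim V p)
    (hXV : X ⊆ realPoints n ⁻¹' V) (hXp : HasProjDim X p) : ZI X = V :=
  hV.eq_of_subset_of_hasProjDim (isProjVariety_ZI X) ((ZI_subset_iff hV.1).2 hXV) hVp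
    (hasProjDim_ZI_iff.2 hXp)

end Complexification

section Cycles

variable {n : ℕ}

theorem ZI_injOn : Set.InjOn (ZI (n := n)) {Y | IsProjVariety Y} := fun Y hY Z hZ h => by
  rw [← preimage_realPoints_ZI hY, h, preimage_realPoints_ZI hZ]

theorem mapsTo_ZI_irredSubvarieties (X : Set (PSpace ℝ n)) (p : ℕ) :
    Set.MapsTo ZI (irredSubvarieties X p) (irredSubvarieties (ZI X) p) :=
  fun _ ⟨hYX, hY, hYp⟩ =>
    ⟨ZI_mono hYX, (isIrredProjVariety_ZI_iff hY.1).2 hY, hasProjDim_ZI_iff.2 hYp⟩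

theorem mapsTo_complexifyCycle (X : Set (PSpace ℝ n)) (p : ℕ) :
    Set.MapsTo (complexifyCycle n) (cycles X p) (cycles (ZI X) p) := by
  classical
  intro c hc Z hZ
  obtain ⟨Y, hY, rfl⟩ := Finset.mem_image.1 (Finsupp.mapDomain_support hZ)
  exact mapsTo_ZI_irredSubvarieties X p (hc hY)

theorem injOn_complexifyCycle (X : Set (PSpace ℝ n)) (p : ℕ) :
    Set.InjOn (complexifyCycle n) (cycles X p) :=
  Finsupp.mapDomain_injOn (irredSubvarieties X p) (ZI_injOn.mono fun _ hY => hY.2.1.1)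

end Cycles

end TotallyReal

open TotallyReal in
theorem mainTheorem8 (n : ℕ) (X : Set (PSpace ℝ n)) (hX : IsProjVariety X) :
    -- (1) `ZI(Y) ∩ X = Y`, as subsets of complex projective space
    (∀ Y : Set (PSpace ℝ n), Y ⊆ X → IsProjVariety Y →
      ZI Y ∩ realPoints n '' X = realPoints n '' Y) ∧
    -- (2)
    (∀ (p : ℕ) (Y : Set (PSpace ℝ n)), Y ⊆ X → IsIrredProjVariety Y → HasProjDim Y p →
      IsIrredProjVariety (ZI Y) ∧ HasProjDim (ZI Y) p ∧ ZI Y ⊆ ZI X) ∧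
    -- (3) `V ∩ X`, as a subset of real projective space, is `realPoints n ⁻¹' V ∩ X`
    (∀ (p : ℕ) (V : Set (PSpace ℂ n)), V ⊆ ZI X → IsIrredProjVariety V → HasProjDim V p →
      HasProjDim (realPoints n ⁻¹' V ∩ X) p →
      IsIrredProjVariety (realPoints n ⁻¹' V ∩ X) ∧ ZI (realPoints n ⁻¹' V ∩ X) = V) ∧
    -- (4) complexification embeds totally real cycles into complex cycles
    (∀ p : ℕ,
      Set.MapsTo (complexifyCycle n) (cycles X p) (cycles (ZI X) p) ∧
      Set.InjOn (complexifyCycle n) (cycles X p) ∧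
      ∀ c ∈ cycles X p, 0 ≤ c → 0 ≤ complexifyCycle n c) := by
  refine ⟨fun Y hYX hY => ?_, fun p Y hYX hY hYp => ?_, fun p V _ hV hVp hWp => ?_, fun p =>
    ⟨mapsTo_complexifyCycle X p, injOn_complexifyCycle X p,
      fun c _ hc => Finsupp.mapDomain_nonneg hc⟩⟩
  · rw [← Set.image_preimage_inter, preimage_realPoints_ZI hY, Set.inter_eq_left.2 hYX]
  · exact ⟨(isIrredProjVariety_ZI_iff hY.1).2 hY, hasProjDim_ZI_iff.2 hYp, ZI_mono hYX⟩
  · have hZI := ZI_eq_of_subset_of_hasProjDim hV hVp Set.inter_subset_left hWp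
    have hW := hV.1.preimage_realPoints.inter hX
    exact ⟨(isIrredProjVariety_ZI_iff hW).1 (hZI.symm ▸ hV), hZI⟩
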